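/- There is a universal constant $C>0$ with the following property. Let $(\Omega,\mu)$ be a finite probability space, let $\alpha$ be the probability of its smallest atom (the least $\mu(\{\omega\})$ among points $\omega$ with $\mu(\{\omega\})>0$), let $n\in\mathbb N$, and let $f:\Omega^n\to\{0,1\}$, where $\Omega^n$ carries the product measure $\mu^{n}$. Let $$I_i(f)=\mathbb E\big[\operatorname{Var}[f\mid x_1,\dots,x_{i-1},x_{i+1},\dots,x_n]\big]$$ be the $L^2$ influence of the $i$-th coordinate. (1) If $f$ is symmetric, i.e. there is a transitive group $\Sigma\subseteq S(n)$ of permutations of the coordinates such that $f(x_{\sigma(1)},\dots,x_{\sigma(n)})=f(x)$ for all $x\in\Omega^n$ and $\sigma\in\Sigma$, then $$\sum_{i=1}^n I_i(f)\ \ge\ \frac{C}{\log(1/\alpha)}\,\log n\;\operatorname{Var}(f).$$ (2) For arbitrary (not necessarily symmetric) $f$, if $\delta>0$ and $I_i(f)\le\delta$ for all $i$, then $$\sum_{i=1}^n I_i(f)\ \ge\ \frac{C}{\log(1/\alpha)}\,\big(\log(1/\delta)-\log(1/4)\big)\operatorname{Var}(f).$$ (If $\alpha=1$, then $\operatorname{Var}(f)=0$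 and the right-hand sides are read as $0$.) -/

import Mathlib

open MeasureTheory ProbabilityTheory

noncomputable section

/-- The product probability measure `μ^n` on `Ω^n`. -/
def powMeasure {Ω : Type*} [MeasurableSpace Ω] (μ : Measure Ω) (n : ℕ) :
    Measure (Fin n → Ω) :=
  Measure.pi fun _ => μ

/-- The `L²` influence of the `i`-th coordinate on `f : Ω^n → ℝ`,
`I_i(f) = E[Var[f | x_1, …, x_{i-1}, x_{i+1}, …, x_n]]`.  Since the coordinates are independent
with law `μ`, the conditional variance at `x` is the variance of `ω ↦ f (x with x_i := ω)`
under `μ`. -/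
def influence {Ω : Type*} [MeasurableSpace Ω] (μ : Measure Ω) {n : ℕ}
    (f : (Fin n → Ω) → ℝ) (i : Fin n) : ℝ :=
  ∫ x, variance (fun ω : Ω => f (Function.update x i ω)) μ ∂(powMeasure μ n)

/-- The size of the smallest atom of a finite probability space: the least probability of a
point, among the points of positive probability. -/
def minAtom {Ω : Type*} [MeasurableSpace Ω] (μ : Measure Ω) : ℝ :=
  ⨅ ω : {ω : Ω // μ {ω} ≠ 0}, μ.real {(ω : Ω)}

/-- `f` is symmetric: it is invariant under some transitive group of permutations of the
coordinates, where `σ` sends `x` to the vector with `i`-th coordinate `x (σ i)`. -/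
def IsSymmetricFun {Ω β : Type*} {n : ℕ} (f : (Fin n → Ω) → β) : Prop :=
  ∃ G : Subgroup (Equiv.Perm (Fin n)), MulAction.IsPretransitive G (Fin n) ∧
    ∀ σ ∈ G, ∀ x : Fin n → Ω, f (fun i => x (σ i)) = f x

end

set_option linter.unusedSectionVars false

/-! This is the Falik–Samorodnitsky argument. Averaging out the coordinates one at a time splits `f
- E f` into martingale differences `d_k`, with `V = Var f = ∑ E d_k²`; the entropies of the `d_k²`
are bounded from both sides. Write `I_k` for the influence of the coordinate averaged at step `k`,
and `I = ∑ I_k`.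

Above: entropy is subadditive over coordinates (`entropy_le_sum`), and on one coordinate a
logarithmic Sobolev inequality holds with constant of order `log (1/α)` (`log_sobolev`). The
energies of the `d_k` in a fixed direction add up to at most that of `f`, so the total entropy is at
most `32 log(1/α) I`.

Below: `f` is 0/1-valued, so `E|d_k| ≤ 2 I_k`, while `E d_k² ≤ I_k`. A function with small first
moment relative to its second has a square of large entropy (`mul_log_le_entropy`); with `I_k ≤ δ`
the total entropy is at least `V log(V/(4δI))`.

Comparing the two gives (2): the loss `V log(I/V)` is itself at most `I`. For (1), symmetry makes
all influences equal: if they are at most `1/√n`, use (2) with `δ = 1/√n`; otherwise their sum is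
already at least `√n`. -/

section FiniteProduct

open Finset Function

/-! ### Product expectations and averaging in one coordinate -/

variable {Ω ι : Type*} [Fintype Ω] [Fintype ι] [DecidableEq ι]

/-- The weighted sum `∑ x, (∏ i, p (x i)) g x`: the expectation for the product weight. -/
noncomputable def prodExp (p : Ω → ℝ) (g : (ι → Ω) → ℝ) : ℝ :=
  ∑ x, (∏ i, p (x i)) * g x

/-- Averaging in the `i`-th coordinate. -/
noncomputable def avg (p : Ω → ℝ) (i : ι) (g : (ι → Ω) → ℝ) (x : ι → Ω) : ℝ :=
  ∑ ω, p ω * g (update x i ω)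

theorem prodExp_add (p : Ω → ℝ) (g h : (ι → Ω) → ℝ) :
    prodExp p (fun x => g x + h x) = prodExp p g + prodExp p h := by
  simp [prodExp, mul_add, sum_add_distrib]

theorem prodExp_sub (p : Ω → ℝ) (g h : (ι → Ω) → ℝ) :
    prodExp p (fun x => g x - h x) = prodExp p g - prodExp p h := by
  simp [prodExp, mul_sub, sum_sub_distrib]

theorem prodExp_const_mul (p : Ω → ℝ) (c : ℝ) (g : (ι → Ω) → ℝ) :
    prodExp p (fun x => c * g x) = c * prodExp p g := by
  simp only [prodExp, mul_sum]
  exact sum_congr rfl fun x _ => by ring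

theorem prodExp_const {p : Ω → ℝ} (hp : ∑ ω, p ω = 1) (c : ℝ) :
    prodExp p (fun _ : ι → Ω => c) = c := by
  have h : ∑ x : ι → Ω, ∏ i, p (x i) = 1 := by
    have := (Finset.prod_univ_sum (fun _ : ι => (univ : Finset Ω)) (fun _ ω => p ω)).symm
    simpa [hp] using this
  rw [prodExp, ← sum_mul, h, one_mul]

theorem prodExp_mono_of_pos {p : Ω → ℝ} (hp0 : ∀ ω, 0 ≤ p ω) {g h : (ι → Ω) → ℝ}
    (H : ∀ x, (∀ i, 0 < p (x i)) → g x ≤ h x) : prodExp p g ≤ prodExp p h := by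
  refine sum_le_sum fun x _ => ?_
  by_cases hx : ∀ i, 0 < p (x i)
  · exact mul_le_mul_of_nonneg_left (H x hx) (prod_nonneg fun _ _ => hp0 _)
  · push Not at hx
    obtain ⟨i, hi⟩ := hx
    have : ∏ i, p (x i) = 0 := prod_eq_zero (mem_univ i) (le_antisymm hi (hp0 _))
    simp [this]

theorem prodExp_mono {p : Ω → ℝ} (hp0 : ∀ ω, 0 ≤ p ω) {g h : (ι → Ω) → ℝ}
    (H : ∀ x, g x ≤ h x) : prodExp p g ≤ prodExp p h :=
  prodExp_mono_of_pos hp0 fun x _ => H x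

theorem prodExp_nonneg {p : Ω → ℝ} (hp0 : ∀ ω, 0 ≤ p ω) {g : (ι → Ω) → ℝ}
    (H : ∀ x, 0 ≤ g x) : 0 ≤ prodExp p g :=
  sum_nonneg fun x _ => mul_nonneg (prod_nonneg fun _ _ => hp0 _) (H x)

theorem prodExp_comp_perm (p : Ω → ℝ) (g : (ι → Ω) → ℝ) (σ : Equiv.Perm ι) :
    prodExp p (fun x => g (fun i => x (σ i))) = prodExp p g := by
  refine Fintype.sum_equiv (Equiv.arrowCongr σ.symm (Equiv.refl Ω)) _ _ fun x => ?_
  have h1 : (Equiv.arrowCongr σ.symm (Equiv.refl Ω)) x = fun i => x (σ i) := by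
    ext i; simp [Equiv.arrowCongr]
  rw [h1, Equiv.prod_comp σ (fun i => p (x i))]

theorem avg_update (p : Ω → ℝ) (i : ι) (g : (ι → Ω) → ℝ) (x : ι → Ω) (ω : Ω) :
    avg p i g (update x i ω) = avg p i g x := by
  simp [avg]

theorem avg_sub (p : Ω → ℝ) (i : ι) (g h : (ι → Ω) → ℝ) :
    avg p i (g - h) = avg p i g - avg p i h := by
  ext x; simp [avg, mul_sub, sum_sub_distrib]

theorem avg_avg {p : Ω → ℝ} (hp : ∑ ω, p ω = 1) (i : ι) (g : (ι → Ω) → ℝ) :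
    avg p i (avg p i g) = avg p i g := by
  ext x
  rw [avg]
  simp only [avg_update, ← sum_mul, hp, one_mul]

theorem avg_comm (p : Ω → ℝ) (i j : ι) (g : (ι → Ω) → ℝ) :
    avg p i (avg p j g) = avg p j (avg p i g) := by
  rcases eq_or_ne i j with rfl | hij
  · rfl
  ext x
  simp only [avg, mul_sum]
  rw [sum_comm]
  refine sum_congr rfl fun a _ => sum_congr rfl fun b _ => ?_
  rw [update_comm hij.symm]
  ring

theorem avg_mul_of_update_eq (p : Ω → ℝ) (i : ι) (g : (ι → Ω) → ℝ) {h : (ι → Ω) → ℝ}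
    (H : ∀ x ω, h (update x i ω) = h x) (x : ι → Ω) :
    avg p i (fun x => g x * h x) x = avg p i g x * h x := by
  simp only [avg, H, sum_mul, mul_assoc]

theorem avg_mono {p : Ω → ℝ} (hp0 : ∀ ω, 0 ≤ p ω) (i : ι) {g h : (ι → Ω) → ℝ}
    (H : ∀ x, g x ≤ h x) (x : ι → Ω) : avg p i g x ≤ avg p i h x :=
  sum_le_sum fun ω _ => mul_le_mul_of_nonneg_left (H _) (hp0 ω)

theorem avg_nonneg {p : Ω → ℝ} (hp0 : ∀ ω, 0 ≤ p ω) (i : ι) {g : (ι → Ω) → ℝ}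
    (H : ∀ x, 0 ≤ g x) (x : ι → Ω) : 0 ≤ avg p i g x :=
  sum_nonneg fun ω _ => mul_nonneg (hp0 ω) (H _)

theorem avg_pos {p : Ω → ℝ} (hp0 : ∀ ω, 0 ≤ p ω) (i : ι) {g : (ι → Ω) → ℝ}
    (H : ∀ x, 0 ≤ g x) {x : ι → Ω} (hx : 0 < p (x i)) (hg : 0 < g x) : 0 < avg p i g x :=
  sum_pos' (fun ω _ => mul_nonneg (hp0 ω) (H _))
    ⟨x i, mem_univ _, by rw [update_eq_self]; exact mul_pos hx hg⟩

theorem abs_avg_le {p : Ω → ℝ} (hp0 : ∀ ω, 0 ≤ p ω) (i : ι) (g : (ι → Ω) → ℝ)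
    (x : ι → Ω) : |avg p i g x| ≤ avg p i (fun x => |g x|) x := by
  refine (abs_sum_le_sum_abs _ _).trans_eq (sum_congr rfl fun ω _ => ?_)
  rw [abs_mul, abs_of_nonneg (hp0 ω)]

theorem prodExp_avg {p : Ω → ℝ} (hp : ∑ ω, p ω = 1) (i : ι) (g : (ι → Ω) → ℝ) :
    prodExp p (avg p i g) = prodExp p g := by
  have hw : ∀ (x : ι → Ω) (ω : Ω),
      (∏ j, p (x j)) * p ω = (∏ j, p (update x i ω j)) * p (x i) := by
    intro x ω
    rw [← mul_prod_erase univ (fun j => p (x j)) (mem_univ i),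
      ← mul_prod_erase univ (fun j => p (update x i ω j)) (mem_univ i)]
    have : ∏ j ∈ univ.erase i, p (update x i ω j) = ∏ j ∈ univ.erase i, p (x j) :=
      prod_congr rfl fun j hj => by rw [update_of_ne (ne_of_mem_erase hj)]
    rw [this, update_self]
    ring
  have h1 : prodExp p (avg p i g) =
      ∑ z : (ι → Ω) × Ω, (∏ j, p (z.1 j)) * p z.2 * g (update z.1 i z.2) := by
    rw [Fintype.sum_prod_type, prodExp]
    refine sum_congr rfl fun x _ => ?_
    rw [avg, mul_sum]
    exact sum_congr rfl fun ω _ => by ring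
  have h2 : prodExp p g = ∑ z : (ι → Ω) × Ω, (∏ j, p (z.1 j)) * p z.2 * g z.1 := by
    rw [Fintype.sum_prod_type, prodExp]
    refine sum_congr rfl fun x _ => ?_
    simp only [← sum_mul, ← mul_sum, hp, mul_one]
  rw [h1, h2]
  -- Exchanging `x i` with the independent sample `ω` is an involution that preserves the weight.
  refine sum_bij' (fun z _ => (update z.1 i z.2, z.1 i)) (fun z _ => (update z.1 i z.2, z.1 i))
    (fun _ _ => mem_univ _) (fun _ _ => mem_univ _) (fun z _ => by simp) (fun z _ => by simp) ?_
  intro z _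
  rw [hw]

theorem prodExp_mul_avg {p : Ω → ℝ} (hp : ∑ ω, p ω = 1) (i : ι) (g h : (ι → Ω) → ℝ) :
    prodExp p (fun x => g x * avg p i h x) = prodExp p (fun x => avg p i g x * avg p i h x) := by
  rw [← prodExp_avg hp i]
  congr 1
  ext x
  exact avg_mul_of_update_eq p i g (avg_update p i h) x

theorem prodExp_sub_avg_sq {p : Ω → ℝ} (hp : ∑ ω, p ω = 1) (i : ι) (g : (ι → Ω) → ℝ) :
    prodExp p (fun x => (g x - avg p i g x) ^ 2) =
      prodExp p (fun x => g x ^ 2) - prodExp p (fun x => avg p i g x ^ 2) := by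
  have h := prodExp_mul_avg hp i g g
  have e : (fun x => (g x - avg p i g x) ^ 2) = fun x =>
      (g x ^ 2 + avg p i g x * avg p i g x) - 2 * (g x * avg p i g x) := by
    ext x; ring
  rw [e, prodExp_sub, prodExp_add, prodExp_const_mul, h]
  simp only [sq]
  ring

/-! ### Successive averages, martingale differences and energies -/

/-- Averaging successively in the coordinates `s 0, …, s (k - 1)`. -/
noncomputable def iterAvg (p : Ω → ℝ) (s : ℕ → ι) (g : (ι → Ω) → ℝ) : ℕ → (ι → Ω) → ℝ
  | 0 => g
  | k + 1 => avg p (s k) (iterAvg p s g k)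

theorem iterAvg_sub (p : Ω → ℝ) (s : ℕ → ι) (g h : (ι → Ω) → ℝ) (k : ℕ) :
    iterAvg p s (g - h) k = iterAvg p s g k - iterAvg p s h k := by
  induction k with
  | zero => rfl
  | succ k ih => simp only [iterAvg, ih, avg_sub]

theorem iterAvg_avg (p : Ω → ℝ) (s : ℕ → ι) (i : ι) (g : (ι → Ω) → ℝ) (k : ℕ) :
    iterAvg p s (avg p i g) k = avg p i (iterAvg p s g k) := by
  induction k with
  | zero => rfl
  | succ k ih => simp only [iterAvg, ih]; rw [avg_comm]

theorem avg_iterAvg_of_lt {p : Ω → ℝ} (hp : ∑ ω, p ω = 1) (s : ℕ → ι) (g : (ι → Ω) → ℝ)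
    {j k : ℕ} (hj : j < k) : avg p (s j) (iterAvg p s g k) = iterAvg p s g k := by
  induction k with
  | zero => omega
  | succ k ih =>
    simp only [iterAvg]
    rcases Nat.lt_succ_iff_lt_or_eq.mp hj with h | rfl
    · rw [avg_comm, ih h]
    · rw [avg_avg hp]

theorem iterAvg_nonneg {p : Ω → ℝ} (hp0 : ∀ ω, 0 ≤ p ω) (s : ℕ → ι) {g : (ι → Ω) → ℝ}
    (H : ∀ x, 0 ≤ g x) (k : ℕ) (x : ι → Ω) : 0 ≤ iterAvg p s g k x := by
  induction k generalizing x with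
  | zero => exact H x
  | succ k ih => exact avg_nonneg hp0 _ ih x

theorem iterAvg_pos {p : Ω → ℝ} (hp0 : ∀ ω, 0 ≤ p ω) (s : ℕ → ι) {g : (ι → Ω) → ℝ}
    (H : ∀ x, 0 ≤ g x) {x : ι → Ω} (hx : ∀ i, 0 < p (x i)) (hg : 0 < g x) (k : ℕ) :
    0 < iterAvg p s g k x := by
  induction k with
  | zero => exact hg
  | succ k ih => exact avg_pos hp0 _ (iterAvg_nonneg hp0 s H k) (hx _) ih

theorem prodExp_iterAvg {p : Ω → ℝ} (hp : ∑ ω, p ω = 1) (s : ℕ → ι) (g : (ι → Ω) → ℝ)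
    (k : ℕ) : prodExp p (iterAvg p s g k) = prodExp p g := by
  induction k with
  | zero => rfl
  | succ k ih => rw [iterAvg, prodExp_avg hp, ih]

theorem prodExp_abs_iterAvg_le {p : Ω → ℝ} (hp0 : ∀ ω, 0 ≤ p ω) (hp : ∑ ω, p ω = 1)
    (s : ℕ → ι) (g : (ι → Ω) → ℝ) (k : ℕ) :
    prodExp p (fun x => |iterAvg p s g k x|) ≤ prodExp p (fun x => |g x|) := by
  induction k with
  | zero => rfl
  | succ k ih =>
    refine le_trans ?_ ih
    rw [← prodExp_avg hp (s k) (fun x => |iterAvg p s g k x|)]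
    exact prodExp_mono hp0 fun x => abs_avg_le hp0 _ _ _

theorem prodExp_iterAvg_sq_le {p : Ω → ℝ} (hp0 : ∀ ω, 0 ≤ p ω) (hp : ∑ ω, p ω = 1)
    (s : ℕ → ι) (g : (ι → Ω) → ℝ) (k : ℕ) :
    prodExp p (fun x => iterAvg p s g k x ^ 2) ≤ prodExp p (fun x => g x ^ 2) := by
  induction k with
  | zero => rfl
  | succ k ih =>
    refine le_trans ?_ ih
    rw [← sub_nonneg, iterAvg, ← prodExp_sub_avg_sq hp]
    exact prodExp_nonneg hp0 fun x => sq_nonneg _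

theorem eq_of_forall_update_eq {g : (ι → Ω) → ℝ} (H : ∀ x i ω, g (update x i ω) = g x)
    (x y : ι → Ω) : g y = g x := by
  classical
  have h : ∀ S : Finset ι, g (S.piecewise y x) = g x := by
    intro S
    induction S using Finset.induction_on with
    | empty => simp
    | insert i S _ ih => rw [Finset.piecewise_insert, H, ih]
  simpa using h univ

theorem iterAvg_eq_prodExp {p : Ω → ℝ} (hp : ∑ ω, p ω = 1) {s : ℕ → ι} {N : ℕ}
    (hs : ∀ i, ∃ j < N, s j = i) (g : (ι → Ω) → ℝ) (x : ι → Ω) :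
    iterAvg p s g N x = prodExp p g := by
  have h : ∀ y, iterAvg p s g N y = iterAvg p s g N x := by
    refine fun y => eq_of_forall_update_eq (fun z i ω => ?_) x y
    obtain ⟨j, hj, rfl⟩ := hs i
    rw [← avg_iterAvg_of_lt hp s g hj, avg_update]
  rw [← prodExp_iterAvg hp s g N, funext h, prodExp_const hp]

/-- The martingale differences of `g` along the order `s` of the coordinates. -/
noncomputable def avgDiff (p : Ω → ℝ) (s : ℕ → ι) (g : (ι → Ω) → ℝ) (k : ℕ) : (ι → Ω) → ℝ :=
  iterAvg p s g k - iterAvg p s g (k + 1)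

theorem avgDiff_eq (p : Ω → ℝ) (s : ℕ → ι) (g : (ι → Ω) → ℝ) (k : ℕ) :
    avgDiff p s g k = iterAvg p s (g - avg p (s k) g) k := by
  rw [iterAvg_sub, iterAvg_avg]; rfl

theorem avgDiff_sub_avg (p : Ω → ℝ) (s : ℕ → ι) (g : (ι → Ω) → ℝ) (k : ℕ) (j : ι) :
    avgDiff p s g k - avg p j (avgDiff p s g k) = avgDiff p s (g - avg p j g) k := by
  simp only [avgDiff, iterAvg_sub, iterAvg_avg, avg_sub]
  abel

theorem sum_avgDiff_sq {p : Ω → ℝ} (hp : ∑ ω, p ω = 1) (s : ℕ → ι) (g : (ι → Ω) → ℝ)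
    (N : ℕ) : ∑ k ∈ range N, prodExp p (fun x => avgDiff p s g k x ^ 2) =
      prodExp p (fun x => g x ^ 2) - prodExp p (fun x => iterAvg p s g N x ^ 2) := by
  have h : ∀ k, prodExp p (fun x => avgDiff p s g k x ^ 2) =
      prodExp p (fun x => iterAvg p s g k x ^ 2) -
        prodExp p (fun x => iterAvg p s g (k + 1) x ^ 2) :=
    fun k => prodExp_sub_avg_sq hp (s k) (iterAvg p s g k)
  simp only [h]
  rw [sum_range_sub']
  rfl

theorem sum_avgDiff_sq_eq_variance {p : Ω → ℝ} (hp : ∑ ω, p ω = 1) {s : ℕ → ι} {N : ℕ}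
    (hs : ∀ i, ∃ j < N, s j = i) (g : (ι → Ω) → ℝ) :
    ∑ k ∈ range N, prodExp p (fun x => avgDiff p s g k x ^ 2) =
      prodExp p (fun x => g x ^ 2) - prodExp p g ^ 2 := by
  rw [sum_avgDiff_sq hp]
  simp only [iterAvg_eq_prodExp hp hs, prodExp_const hp]

/-- The energy of `g` in the direction of the `i`-th coordinate. -/
noncomputable def coordEnergy (p : Ω → ℝ) (g : (ι → Ω) → ℝ) (i : ι) : ℝ :=
  prodExp p (fun x => (g x - avg p i g x) ^ 2)

/-- Averages commute, so the energy of the `k`-th difference in direction `j` is the squared norm of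
the `k`-th difference of `g - avg p j g`, and these squared norms telescope. -/
theorem sum_coordEnergy_avgDiff_le {p : Ω → ℝ} (hp0 : ∀ ω, 0 ≤ p ω) (hp : ∑ ω, p ω = 1)
    (s : ℕ → ι) (g : (ι → Ω) → ℝ) (N : ℕ) (j : ι) :
    ∑ k ∈ range N, coordEnergy p (avgDiff p s g k) j ≤ coordEnergy p g j := by
  have h : ∀ k, coordEnergy p (avgDiff p s g k) j =
      prodExp p (fun x => avgDiff p s (g - avg p j g) k x ^ 2) := by
    intro k
    rw [← avgDiff_sub_avg]
    rfl
  simp only [h]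
  rw [sum_avgDiff_sq hp]
  exact sub_le_self _ (prodExp_nonneg hp0 fun _ => sq_nonneg _)

theorem prodExp_avgDiff_sq_le {p : Ω → ℝ} (hp0 : ∀ ω, 0 ≤ p ω) (hp : ∑ ω, p ω = 1)
    (s : ℕ → ι) (g : (ι → Ω) → ℝ) (k : ℕ) :
    prodExp p (fun x => avgDiff p s g k x ^ 2) ≤ coordEnergy p g (s k) := by
  rw [avgDiff_eq]
  exact prodExp_iterAvg_sq_le hp0 hp s _ k

/-- Each martingale difference is an average of `g - avg p (s k) g`, and averaging contracts `L²`.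
The hypothesis `hsum` says that `s` lists every coordinate exactly once. -/
theorem variance_le_sum_coordEnergy {p : Ω → ℝ} (hp0 : ∀ ω, 0 ≤ p ω) (hp : ∑ ω, p ω = 1)
    {s : ℕ → ι} {N : ℕ} (hs : ∀ i, ∃ j < N, s j = i)
    (hsum : ∀ h : ι → ℝ, ∑ k ∈ range N, h (s k) = ∑ i, h i) (g : (ι → Ω) → ℝ) :
    prodExp p (fun x => g x ^ 2) - prodExp p g ^ 2 ≤ ∑ i, coordEnergy p g i := by
  rw [← sum_avgDiff_sq_eq_variance hp hs, ← hsum]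
  exact sum_le_sum fun k _ => prodExp_avgDiff_sq_le hp0 hp s g k

/-- Averaging contracts `L¹`, and for 0/1-valued `f` with conditional mean `q` one has `|f - q| = f
+ q - 2fq`, whose mean `2(E f - E q²)` is twice the energy. -/
theorem prodExp_abs_avgDiff_le {p : Ω → ℝ} (hp0 : ∀ ω, 0 ≤ p ω) (hp : ∑ ω, p ω = 1)
    (s : ℕ → ι) {f : (ι → Ω) → ℝ} (hf : ∀ x, f x = 0 ∨ f x = 1) (k : ℕ) :
    prodExp p (fun x => |avgDiff p s f k x|) ≤ 2 * coordEnergy p f (s k) := by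
  rw [avgDiff_eq]
  refine (prodExp_abs_iterAvg_le hp0 hp s _ k).trans_eq ?_
  set i := s k
  have hq0 : ∀ x, 0 ≤ avg p i f x :=
    avg_nonneg hp0 i fun x => by rcases hf x with h | h <;> simp [h]
  have hq1 : ∀ x, avg p i f x ≤ 1 := fun x => by
    refine (avg_mono (h := fun _ => 1) hp0 i (fun x => ?_) x).trans_eq ?_
    · rcases hf x with h | h <;> simp [h]
    · simp [avg, hp]
  have h1 : (fun x => |(f - avg p i f) x|) =
      fun x => (f x + avg p i f x) - 2 * (f x * avg p i f x) := by
    ext x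
    rw [Pi.sub_apply]
    rcases hf x with h | h
    · rw [h, zero_sub, abs_neg, abs_of_nonneg (hq0 x)]; ring
    · rw [h, abs_of_nonneg (sub_nonneg.2 (hq1 x))]; ring
  have h2 : (fun x => f x ^ 2) = f := by
    ext x; rcases hf x with h | h <;> simp [h]
  rw [h1, coordEnergy, prodExp_sub_avg_sq hp, prodExp_sub, prodExp_add, prodExp_const_mul,
    prodExp_mul_avg hp, prodExp_avg hp, h2]
  simp only [sq]
  ring

theorem coordEnergy_perm (p : Ω → ℝ) {f : (ι → Ω) → ℝ} (σ : Equiv.Perm ι)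
    (hf : ∀ x : ι → Ω, f (fun i => x (σ i)) = f x) (i : ι) :
    coordEnergy p f (σ i) = coordEnergy p f i := by
  rw [coordEnergy, coordEnergy, ← prodExp_comp_perm p (fun x => (f x - avg p i f x) ^ 2) σ]
  have h : ∀ x, avg p (σ i) f x = avg p i f (fun j => x (σ j)) := fun x => by
    refine sum_congr rfl fun ω _ => ?_
    rw [← hf (update x (σ i) ω)]
    congr 2
    ext j
    by_cases hj : j = i
    · subst hj; simp
    · rw [update_of_ne hj, update_of_ne (fun e => hj (σ.injective e))]
  simp only [hf, h]

/-! ### Entropy -/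

/-- Subadditivity of entropy. -/
theorem entropy_le_sum {p : Ω → ℝ} (hp0 : ∀ ω, 0 ≤ p ω) (hp : ∑ ω, p ω = 1) {s : ℕ → ι} {N : ℕ}
    (hs : ∀ i, ∃ j < N, s j = i) {F : (ι → Ω) → ℝ} (hF : ∀ x, 0 ≤ F x) :
    prodExp p (fun x => F x * Real.log (F x)) - prodExp p F * Real.log (prodExp p F) ≤
      ∑ k ∈ range N, prodExp p (fun x => F x * Real.log (F x) -
        avg p (s k) F x * Real.log (avg p (s k) F x)) := by
  -- The left sides telescope to the entropy of `F`. Each is at most the mean entropy of `F` in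
  -- coordinate `s k`, by a Gibbs inequality.
  have key : ∀ k, prodExp p (fun x => F x * Real.log (iterAvg p s F k x)) -
      prodExp p (fun x => F x * Real.log (iterAvg p s F (k + 1) x)) ≤
      prodExp p (fun x => F x * Real.log (F x) -
        avg p (s k) F x * Real.log (avg p (s k) F x)) := by
    intro k
    set i := s k
    set G := iterAvg p s F k with hG
    have hG0 : ∀ x, 0 ≤ G x := iterAvg_nonneg hp0 s hF k
    have e1 : prodExp p (fun x => avg p i F x * Real.log (avg p i F x)) =
        prodExp p (fun x => F x * Real.log (avg p i F x)) := by
      rw [← prodExp_avg hp i (fun x => F x * Real.log (avg p i F x))]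
      congr 1
      ext x
      exact (avg_mul_of_update_eq p i F (h := fun x => Real.log (avg p i F x))
        (fun x ω => by simp only [avg_update]) x).symm
    have e2 : prodExp p (fun x => G x * (avg p i F x / avg p i G x)) ≤ prodExp p F := by
      rw [← prodExp_avg hp i (fun x => G x * (avg p i F x / avg p i G x)),
        ← prodExp_avg hp i F]
      refine prodExp_mono hp0 fun x => ?_
      have : avg p i (fun x => G x * (avg p i F x / avg p i G x)) x =
          avg p i G x * (avg p i F x / avg p i G x) :=
        avg_mul_of_update_eq p i G (h := fun x => avg p i F x / avg p i G x)
          (fun x ω => by simp only [avg_update]) x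
      rw [this]
      by_cases h0 : avg p i G x = 0
      · rw [h0, zero_mul]; exact avg_nonneg hp0 i hF x
      · rw [mul_div_cancel₀ _ h0]
    -- This is `log t ≥ 1 - 1/t` at `t = F · avg G / (avg F · G)`, multiplied by `F`; by `e2` the
    -- left side is nonnegative.
    have e3 : prodExp p (fun x => F x - G x * (avg p i F x / avg p i G x)) ≤
        prodExp p (fun x => (F x * Real.log (F x) - F x * Real.log (avg p i F x)) -
          (F x * Real.log (G x) - F x * Real.log (avg p i G x))) := by
      refine prodExp_mono_of_pos hp0 fun x hx => ?_
      rcases (hF x).eq_or_lt with h0 | h0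
      · rw [← h0]
        simp only [zero_mul, sub_zero, zero_sub, Left.neg_nonpos_iff]
        exact mul_nonneg (hG0 x) (div_nonneg (avg_nonneg hp0 i hF x) (avg_nonneg hp0 i hG0 x))
      · have g1 : 0 < avg p i F x := avg_pos hp0 i hF (hx i) h0
        have g2 : 0 < G x := iterAvg_pos hp0 s hF hx h0 k
        have g3 : 0 < avg p i G x := avg_pos hp0 i hG0 (hx i) g2
        have hl := Real.one_sub_inv_le_log_of_pos
          (x := F x * avg p i G x / (avg p i F x * G x)) (by positivity)
        rw [Real.log_div (by positivity) (by positivity), Real.log_mul h0.ne' g3.ne',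
          Real.log_mul g1.ne' g2.ne'] at hl
        have := mul_le_mul_of_nonneg_left hl h0.le
        have e : F x * (1 - (F x * avg p i G x / (avg p i F x * G x))⁻¹) =
            F x - G x * (avg p i F x / avg p i G x) := by
          field_simp
        rw [e] at this
        linarith
    rw [prodExp_sub, prodExp_sub, prodExp_sub, prodExp_sub] at e3
    rw [prodExp_sub, e1]
    change _ - prodExp p (fun x => F x * Real.log (avg p i G x)) ≤ _
    linarith
  refine le_trans (le_of_eq ?_) (sum_le_sum fun k _ => key k)
  rw [sum_range_sub']
  simp only [iterAvg_eq_prodExp hp hs]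
  congr 1
  simp only [mul_comm _ (Real.log (prodExp p F))]
  rw [prodExp_const_mul]

/-- Entropy of `g ^ 2` is large when `g` has small first moment. -/
theorem mul_log_le_entropy {p : Ω → ℝ} (hp0 : ∀ ω, 0 ≤ p ω)
    (g : (ι → Ω) → ℝ) {c : ℝ} (hc : prodExp p (fun x => |g x|) ^ 2 ≤ c)
    (hg : 0 < prodExp p (fun x => g x ^ 2)) :
    prodExp p (fun x => g x ^ 2) * Real.log (prodExp p (fun x => g x ^ 2) / c) ≤
      prodExp p (fun x => g x ^ 2 * Real.log (g x ^ 2)) -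
        prodExp p (fun x => g x ^ 2) * Real.log (prodExp p (fun x => g x ^ 2)) := by
  set m1 := prodExp p (fun x => |g x|) with hm1
  set m2 := prodExp p (fun x => g x ^ 2) with hm2
  have h1 : 0 < m1 := by
    refine (prodExp_nonneg hp0 fun x => abs_nonneg _).lt_of_ne fun h0 => hg.ne' ?_
    have hz : ∀ x ∈ (univ : Finset (ι → Ω)), (∏ i, p (x i)) * |g x| = 0 :=
      (sum_eq_zero_iff_of_nonneg fun x _ =>
        mul_nonneg (prod_nonneg fun _ _ => hp0 _) (abs_nonneg _)).1 h0.symm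
    refine sum_eq_zero fun x hx => ?_
    beta_reduce
    rw [← sq_abs, sq, ← mul_assoc, hz x hx, zero_mul]
  have h3 : m2 * Real.log (m2 / c) ≤ m2 * Real.log (m2 / m1 ^ 2) := by
    refine mul_le_mul_of_nonneg_left (Real.log_le_log ?_ ?_) hg.le
    · exact div_pos hg (lt_of_lt_of_le (by positivity) hc)
    · exact div_le_div_of_nonneg_left hg.le (by positivity) hc
  refine h3.trans ?_
  -- Jensen for `log` under the weight `g² / m2`, through the tangent bound at `|g| = m2 / m1`; the
  -- left side has mean zero.
  have h4 : prodExp p (fun x => 2 * (g x ^ 2 - m2 / m1 * |g x|)) ≤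
      prodExp p (fun x => g x ^ 2 * Real.log (g x ^ 2) -
        (2 * Real.log m2 - 2 * Real.log m1) * g x ^ 2) := by
    refine prodExp_mono hp0 fun x => ?_
    rcases eq_or_ne (g x) 0 with h0 | h0
    · simp [h0]
    have ha : 0 < |g x| := abs_pos.2 h0
    have hl := Real.one_sub_inv_le_log_of_pos (x := |g x| * m1 / m2) (by positivity)
    rw [Real.log_div (by positivity) (by positivity), Real.log_mul ha.ne' h1.ne'] at hl
    have := mul_le_mul_of_nonneg_left hl (sq_nonneg |g x|)
    have e : |g x| ^ 2 * (1 - (|g x| * m1 / m2)⁻¹) = |g x| ^ 2 - m2 / m1 * |g x| := by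
      field_simp
    rw [e] at this
    rw [← sq_abs (g x), Real.log_pow]
    push_cast
    linarith
  rw [prodExp_const_mul, prodExp_sub, prodExp_const_mul, prodExp_sub, prodExp_const_mul, ← hm1,
    ← hm2, div_mul_cancel₀ _ h1.ne', sub_self, mul_zero] at h4
  rw [Real.log_div hg.ne' (by positivity), Real.log_pow]
  push_cast
  linarith

/-- With `v = E g²`, the hypotheses give `(E|g|)² ≤ 4δJ`, hence entropy at least `v log(v/(4δJ))`.
The log-sum inequality is linearised here: the correction `v - (V/I) J` vanishes once summed over
terms whose `v` and `J` total `V` and `I`. -/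
theorem mul_log_add_le_entropy {p : Ω → ℝ} (hp0 : ∀ ω, 0 ≤ p ω) (g : (ι → Ω) → ℝ)
    {I J V δ : ℝ} (hI : 0 < I) (hV : 0 < V) (hδ : 0 < δ) (hJδ : J ≤ δ)
    (h1 : prodExp p (fun x => |g x|) ≤ 2 * J) (hgJ : prodExp p (fun x => g x ^ 2) ≤ J) :
    prodExp p (fun x => g x ^ 2) * Real.log (V / (4 * δ * I)) +
        (prodExp p (fun x => g x ^ 2) - V / I * J) ≤
      prodExp p (fun x => g x ^ 2 * Real.log (g x ^ 2)) -
        prodExp p (fun x => g x ^ 2) * Real.log (prodExp p (fun x => g x ^ 2)) := by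
  have hv0 : 0 ≤ prodExp p (fun x => g x ^ 2) := prodExp_nonneg hp0 fun _ => sq_nonneg _
  rcases hv0.eq_or_lt with hk | hk
  · have hz : ∀ x ∈ (univ : Finset (ι → Ω)), (∏ i, p (x i)) * g x ^ 2 = 0 :=
      (sum_eq_zero_iff_of_nonneg fun x _ =>
        mul_nonneg (prod_nonneg fun _ _ => hp0 _) (sq_nonneg _)).1 hk.symm
    have hE : prodExp p (fun x => g x ^ 2 * Real.log (g x ^ 2)) = 0 :=
      sum_eq_zero fun x hx => by rw [← mul_assoc, hz x hx, zero_mul]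
    rw [hE, ← hk]
    have hJ0 : 0 ≤ J := hv0.trans hgJ
    have : 0 ≤ V / I * J := by positivity
    linarith
  have hJ : 0 < J := hk.trans_le hgJ
  have hc : prodExp p (fun x => |g x|) ^ 2 ≤ 4 * δ * J := by
    have h2 : 0 ≤ prodExp p (fun x => |g x|) := prodExp_nonneg hp0 fun _ => abs_nonneg _
    nlinarith
  refine le_trans ?_ (mul_log_le_entropy hp0 g hc hk)
  generalize prodExp p (fun x => g x ^ 2) = v at hk
  have hl := Real.one_sub_inv_le_log_of_pos (x := v * I / (J * V)) (by positivity)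
  have e1 : Real.log (v / (4 * δ * J)) =
      Real.log (V / (4 * δ * I)) + Real.log (v * I / (J * V)) := by
    rw [← Real.log_mul (by positivity) (by positivity)]
    congr 1
    field_simp
  have e2 : v * (1 - (v * I / (J * V))⁻¹) = v - V / I * J := by
    field_simp
  have := mul_le_mul_of_nonneg_left hl hk.le
  rw [e2] at this
  rw [e1, mul_add]
  linarith

/-! ### The logarithmic Sobolev inequality -/

/-- For `|t| ≤ 2` the left side is at most `(t² - 1)²`, and `(t + 1)² ≤ 9 ≤ 16 log 2`. For `|t| ≥ 2`
it is at most `t² L`, and `t² ≤ 4(t - 1)²`. -/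
theorem sq_mul_log_sq_le {L t : ℝ} (hL : Real.log 2 ≤ L) (ht : t ≠ 0 → Real.log (t ^ 2) ≤ L) :
    t ^ 2 * Real.log (t ^ 2) - t ^ 2 + 1 ≤ 16 * L * (t - 1) ^ 2 := by
  have hl2 := Real.log_two_gt_d9
  rcases eq_or_ne t 0 with rfl | h0
  · norm_num; linarith
  have ht2 : 0 < t ^ 2 := by positivity
  rcases le_total |t| 2 with h | h
  · have h1 := Real.log_le_sub_one_of_pos ht2
    have h2 : t ^ 2 * Real.log (t ^ 2) ≤ t ^ 2 * (t ^ 2 - 1) :=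
      mul_le_mul_of_nonneg_left h1 ht2.le
    rw [abs_le] at h
    have h3 : (t + 1) ^ 2 ≤ 16 * L := by nlinarith
    have h4 := mul_le_mul_of_nonneg_right h3 (sq_nonneg (t - 1))
    nlinarith
  · have h2 : t ^ 2 * Real.log (t ^ 2) ≤ t ^ 2 * L :=
      mul_le_mul_of_nonneg_left (ht h0) ht2.le
    have h3 : 4 ≤ t ^ 2 := by rw [← sq_abs]; nlinarith
    have h4 : t ^ 2 ≤ 4 * (t - 1) ^ 2 := by
      rcases le_abs'.1 h with h | h <;> nlinarith
    have h5 : t ^ 2 * L ≤ 4 * (t - 1) ^ 2 * L := mul_le_mul_of_nonneg_right h4 (by linarith)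
    nlinarith [mul_nonneg (sq_nonneg (t - 1)) (by linarith : 0 ≤ L)]

/-- The pointwise bound is applied to `t = g / b`, where `b` is the `L²` norm of `g`. An atom of
mass at least `a` forces `t² ≤ 1/a`, so `L = log(1/a)` is admissible. -/
theorem log_sobolev_of_nonneg_mean {p : Ω → ℝ} (hp0 : ∀ ω, 0 ≤ p ω) (hp : ∑ ω, p ω = 1) {a : ℝ}
    (ha : 0 < a) (ha2 : a ≤ 1 / 2) (hpa : ∀ ω, p ω ≠ 0 → a ≤ p ω) (g : Ω → ℝ)
    (hm : 0 ≤ ∑ ω, p ω * g ω) :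
    ∑ ω, p ω * (g ω ^ 2 * Real.log (g ω ^ 2)) -
        (∑ ω, p ω * g ω ^ 2) * Real.log (∑ ω, p ω * g ω ^ 2) ≤
      32 * Real.log (1 / a) * (∑ ω, p ω * g ω ^ 2 - (∑ ω, p ω * g ω) ^ 2) := by
  set m := ∑ ω, p ω * g ω with hmdef
  set c := ∑ ω, p ω * g ω ^ 2 with hc
  have hterm : ∀ ω ∈ univ, 0 ≤ p ω * g ω ^ 2 := fun ω _ => mul_nonneg (hp0 ω) (sq_nonneg _)
  have hL : Real.log 2 ≤ Real.log (1 / a) :=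
    Real.log_le_log (by norm_num) (by rw [le_div_iff₀ ha]; linarith)
  set L := Real.log (1 / a)
  have hL0 : 0 < L := (Real.log_pos (by norm_num)).trans_le hL
  have hvar : 0 ≤ c - m ^ 2 := by
    have : c - m ^ 2 = ∑ ω, p ω * (g ω - m) ^ 2 := by
      have e : ∀ ω, p ω * (g ω - m) ^ 2 = p ω * g ω ^ 2 - 2 * m * (p ω * g ω) + m ^ 2 * p ω :=
        fun ω => by ring
      simp only [e, sum_add_distrib, sum_sub_distrib, ← mul_sum, hp, ← hmdef, ← hc]
      ring
    rw [this]
    exact sum_nonneg fun ω _ => mul_nonneg (hp0 ω) (sq_nonneg _)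
  rcases (sum_nonneg hterm).eq_or_lt with h0 | h0
  · have hz := (sum_eq_zero_iff_of_nonneg hterm).1 h0.symm
    have : ∑ ω, p ω * (g ω ^ 2 * Real.log (g ω ^ 2)) = 0 :=
      sum_eq_zero fun ω hω => by rw [← mul_assoc, hz ω hω, zero_mul]
    have hc0 : c = 0 := h0.symm
    rw [hc0] at hvar
    rw [this, hc0, zero_mul, sub_zero]
    exact mul_nonneg (by positivity) hvar
  rw [← hc] at h0
  set b := Real.sqrt c
  have hb : 0 < b := Real.sqrt_pos.2 h0
  have hb2 : b ^ 2 = c := Real.sq_sqrt h0.le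
  have hpt : ∀ ω, p ω * (g ω ^ 2 * Real.log (g ω ^ 2)) - p ω * g ω ^ 2 * Real.log c -
      p ω * g ω ^ 2 + c * p ω ≤ 16 * L * (p ω * (g ω - b) ^ 2) := by
    intro ω
    rcases eq_or_ne (p ω) 0 with hz | hz
    · simp [hz]
    have hpω : 0 < p ω := (hp0 ω).lt_of_ne' hz
    have ht : g ω / b ≠ 0 → Real.log ((g ω / b) ^ 2) ≤ L := by
      intro hne
      refine Real.log_le_log (by positivity) ?_
      rw [div_pow, hb2, div_le_div_iff₀ h0 ha, one_mul]
      calc g ω ^ 2 * a ≤ g ω ^ 2 * p ω := mul_le_mul_of_nonneg_left (hpa ω hz) (sq_nonneg _)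
        _ = p ω * g ω ^ 2 := mul_comm _ _
        _ ≤ c := single_le_sum hterm (mem_univ ω)
    have hs := mul_le_mul_of_nonneg_left (sq_mul_log_sq_le hL ht) (mul_pos hpω h0).le
    have e1 : p ω * c * (16 * L * (g ω / b - 1) ^ 2) = 16 * L * (p ω * (g ω - b) ^ 2) := by
      rw [← hb2]; field_simp
    have e2 : p ω * c * ((g ω / b) ^ 2 * Real.log ((g ω / b) ^ 2) - (g ω / b) ^ 2 + 1) =
        p ω * (g ω ^ 2 * Real.log (g ω ^ 2)) - p ω * g ω ^ 2 * Real.log c -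
          p ω * g ω ^ 2 + c * p ω := by
      rcases eq_or_ne (g ω) 0 with hg | hg
      · simp [hg, mul_comm]
      · rw [div_pow, hb2, Real.log_div (by positivity) h0.ne']
        field_simp
    rw [e1, e2] at hs
    exact hs
  have hsum := sum_le_sum fun ω (_ : ω ∈ univ) => hpt ω
  have e : ∀ ω, p ω * (g ω - b) ^ 2 = p ω * g ω ^ 2 - 2 * b * (p ω * g ω) + b ^ 2 * p ω :=
    fun ω => by ring
  simp only [e, sum_add_distrib, sum_sub_distrib, ← mul_sum, ← sum_mul, hp, ← hmdef, ← hc]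
    at hsum
  have hmb : m ≤ b := Real.le_sqrt_of_sq_le (by linarith)
  -- The distance to the norm `b` is traded for the variance; this needs `0 ≤ m ≤ b`.
  have h1 : c - 2 * b * m + b ^ 2 * 1 ≤ 2 * (c - m ^ 2) := by
    rw [← hb2]; nlinarith
  have h2 := mul_le_mul_of_nonneg_left h1 (by positivity : 0 ≤ 16 * L)
  linarith

theorem log_sobolev {p : Ω → ℝ} (hp0 : ∀ ω, 0 ≤ p ω) (hp : ∑ ω, p ω = 1) {a : ℝ}
    (ha : 0 < a) (ha2 : a ≤ 1 / 2) (hpa : ∀ ω, p ω ≠ 0 → a ≤ p ω) (g : Ω → ℝ) :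
    ∑ ω, p ω * (g ω ^ 2 * Real.log (g ω ^ 2)) -
        (∑ ω, p ω * g ω ^ 2) * Real.log (∑ ω, p ω * g ω ^ 2) ≤
      32 * Real.log (1 / a) * (∑ ω, p ω * g ω ^ 2 - (∑ ω, p ω * g ω) ^ 2) := by
  rcases le_total 0 (∑ ω, p ω * g ω) with h | h
  · exact log_sobolev_of_nonneg_mean hp0 hp ha ha2 hpa g h
  · have := log_sobolev_of_nonneg_mean hp0 hp ha ha2 hpa (-g) (by simpa using h)
    simpa using this

theorem log_sobolev_coord {p : Ω → ℝ} (hp0 : ∀ ω, 0 ≤ p ω) (hp : ∑ ω, p ω = 1) {a : ℝ}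
    (ha : 0 < a) (ha2 : a ≤ 1 / 2) (hpa : ∀ ω, p ω ≠ 0 → a ≤ p ω) (g : (ι → Ω) → ℝ) (i : ι) :
    prodExp p (fun x => g x ^ 2 * Real.log (g x ^ 2) -
        avg p i (fun x => g x ^ 2) x * Real.log (avg p i (fun x => g x ^ 2) x)) ≤
      32 * Real.log (1 / a) * coordEnergy p g i := by
  rw [coordEnergy, prodExp_sub_avg_sq hp, prodExp_sub,
    ← prodExp_avg hp i (fun x => g x ^ 2 * Real.log (g x ^ 2)),
    ← prodExp_avg hp i (fun x => g x ^ 2), ← prodExp_sub, ← prodExp_sub, ← prodExp_const_mul]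
  exact prodExp_mono hp0 fun x => log_sobolev hp0 hp ha ha2 hpa fun ω => g (update x i ω)

/-- The Falik–Samorodnitsky inequality, in terms of the bound `δ` on the energies. -/
theorem log_mul_variance_le {p : Ω → ℝ} (hp0 : ∀ ω, 0 ≤ p ω) (hp : ∑ ω, p ω = 1) {a : ℝ}
    (ha : 0 < a) (ha2 : a ≤ 1 / 2) (hpa : ∀ ω, p ω ≠ 0 → a ≤ p ω) {s : ℕ → ι} {N : ℕ}
    (hs : ∀ i, ∃ j < N, s j = i)
    (hsum : ∀ h : ι → ℝ, ∑ k ∈ range N, h (s k) = ∑ i, h i)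
    {f : (ι → Ω) → ℝ} (hf : ∀ x, f x = 0 ∨ f x = 1) {δ : ℝ} (hδ : 0 < δ)
    (hI : ∀ i, coordEnergy p f i ≤ δ) :
    Real.log (4 / δ) * (prodExp p (fun x => f x ^ 2) - prodExp p f ^ 2) ≤
      38 * Real.log (1 / a) * ∑ i, coordEnergy p f i := by
  have hL : Real.log 2 ≤ Real.log (1 / a) :=
    Real.log_le_log (by norm_num) (by rw [le_div_iff₀ ha]; linarith)
  set L := Real.log (1 / a)
  have hl2 := Real.log_two_gt_d9
  set d := avgDiff p s f
  set v : ℕ → ℝ := fun k => prodExp p (fun x => d k x ^ 2) with hv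
  set I := ∑ i, coordEnergy p f i with hIdef
  have hV := sum_avgDiff_sq_eq_variance hp hs f
  rw [← hV]
  change Real.log (4 / δ) * (∑ k ∈ range N, v k) ≤ _
  have hv0 : ∀ k, 0 ≤ v k := fun k => prodExp_nonneg hp0 fun _ => sq_nonneg _
  have hvI : ∀ k, v k ≤ coordEnergy p f (s k) := fun k => prodExp_avgDiff_sq_le hp0 hp s f k
  have hVI : ∑ k ∈ range N, v k ≤ I := hV.trans_le (variance_le_sum_coordEnergy hp0 hp hs hsum f)
  set V := ∑ k ∈ range N, v k with hVdef
  have hV0 : 0 ≤ V := sum_nonneg fun k _ => hv0 k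
  rcases hV0.eq_or_lt with h0 | h0
  · rw [← h0, mul_zero]
    rw [← h0] at hVI
    exact mul_nonneg (by linarith) hVI
  have hI0 : 0 < I := h0.trans_le hVI
  have hent : ∀ k, prodExp p (fun x => d k x ^ 2 * Real.log (d k x ^ 2)) -
      v k * Real.log (v k) ≤ 32 * L * ∑ j, coordEnergy p (d k) j := by
    intro k
    refine (entropy_le_sum hp0 hp hs (F := fun x => d k x ^ 2) fun x => sq_nonneg _).trans ?_
    rw [← hsum, mul_sum]
    exact sum_le_sum fun j _ => log_sobolev_coord hp0 hp ha ha2 hpa (d k) (s j)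
  have hentsum : ∑ k ∈ range N, (prodExp p (fun x => d k x ^ 2 * Real.log (d k x ^ 2)) -
      v k * Real.log (v k)) ≤ 32 * L * I := by
    refine (sum_le_sum fun k _ => hent k).trans ?_
    rw [← mul_sum, sum_comm]
    exact mul_le_mul_of_nonneg_left
      (sum_le_sum fun j _ => sum_coordEnergy_avgDiff_le hp0 hp s f N j) (by linarith)
  have hlow : ∀ k, v k * Real.log (V / (4 * δ * I)) +
      (v k - V / I * coordEnergy p f (s k)) ≤
      prodExp p (fun x => d k x ^ 2 * Real.log (d k x ^ 2)) - v k * Real.log (v k) := by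
    intro k
    exact mul_log_add_le_entropy hp0 (d k) hI0 h0 hδ (hI (s k))
      (prodExp_abs_avgDiff_le hp0 hp s hf k) (hvI k)
  have hlowsum := (sum_le_sum fun k (_ : k ∈ range N) => hlow k).trans hentsum
  rw [sum_add_distrib, sum_sub_distrib, ← sum_mul, ← mul_sum, hsum, ← hIdef, ← hVdef,
    div_mul_cancel₀ _ hI0.ne', sub_self, add_zero] at hlowsum
  -- After multiplication by `V` the three terms cost `32 L I`, `I ≤ 2 L I` and `4 L I`, whence 38.
  have e : Real.log (4 / δ) = Real.log (V / (4 * δ * I)) + Real.log (I / V) + 4 * Real.log 2 := by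
    rw [← Real.log_mul (by positivity) (by positivity)]
    have : 4 * Real.log 2 = Real.log (2 ^ 4) := by rw [Real.log_pow]; norm_num
    rw [this, ← Real.log_mul (by positivity) (by positivity)]
    congr 1
    field_simp
    norm_num
  have h1 : Real.log (I / V) * V ≤ I := by
    have := mul_le_mul_of_nonneg_right (Real.log_le_sub_one_of_pos (div_pos hI0 h0)) h0.le
    rw [sub_mul, div_mul_cancel₀ _ h0.ne'] at this
    linarith
  have h2 : Real.log 2 * V ≤ L * I := mul_le_mul hL hVI h0.le (by linarith)
  have h3 : I ≤ 2 * L * I := by nlinarith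
  rw [e]
  linarith

end FiniteProduct

/-! ### From measures to weighted sums -/

section FiniteMeasure

variable {Ω : Type*} [Fintype Ω] [MeasurableSpace Ω] [MeasurableSingletonClass Ω]

theorem integral_eq_sum_measureReal (μ : Measure Ω) [IsProbabilityMeasure μ] (g : Ω → ℝ) :
    ∫ ω, g ω ∂μ = ∑ ω, μ.real {ω} * g ω := by
  rw [integral_fintype Integrable.of_finite]
  simp

theorem variance_eq_sum_measureReal (μ : Measure Ω) [IsProbabilityMeasure μ] (g : Ω → ℝ) :
    variance g μ = ∫ ω, g ω ^ 2 ∂μ - (∫ ω, g ω ∂μ) ^ 2 := by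
  rw [variance_eq_sub MemLp.of_discrete]
  rfl

theorem sum_measureReal_singleton_eq_one (μ : Measure Ω) [IsProbabilityMeasure μ] :
    ∑ ω, μ.real {ω} = 1 := by
  simp

instance powMeasure.instIsProbabilityMeasure (μ : Measure Ω) [IsProbabilityMeasure μ] (n : ℕ) :
    IsProbabilityMeasure (powMeasure μ n) := by
  unfold powMeasure; infer_instance

theorem integral_powMeasure (μ : Measure Ω) [IsProbabilityMeasure μ] {n : ℕ}
    (g : (Fin n → Ω) → ℝ) :
    ∫ x, g x ∂(powMeasure μ n) = prodExp (fun ω => μ.real {ω}) g := by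
  rw [integral_eq_sum_measureReal, prodExp]
  refine Finset.sum_congr rfl fun x _ => ?_
  simp [powMeasure, Measure.real, Measure.pi_singleton, ENNReal.toReal_prod]

theorem variance_powMeasure (μ : Measure Ω) [IsProbabilityMeasure μ] {n : ℕ}
    (g : (Fin n → Ω) → ℝ) :
    variance g (powMeasure μ n) = prodExp (fun ω => μ.real {ω}) (fun x => g x ^ 2) -
      prodExp (fun ω => μ.real {ω}) g ^ 2 := by
  rw [variance_eq_sum_measureReal, integral_powMeasure, integral_powMeasure]

theorem influence_eq_coordEnergy (μ : Measure Ω) [IsProbabilityMeasure μ] {n : ℕ}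
    (g : (Fin n → Ω) → ℝ) (i : Fin n) :
    influence μ g i = coordEnergy (fun ω => μ.real {ω}) g i := by
  have hp := sum_measureReal_singleton_eq_one μ
  rw [influence, integral_powMeasure, coordEnergy, prodExp_sub_avg_sq hp,
    ← prodExp_avg hp i (fun x => g x ^ 2), ← prodExp_sub]
  congr 1
  ext x
  rw [variance_eq_sum_measureReal, integral_eq_sum_measureReal, integral_eq_sum_measureReal]
  rfl

theorem minAtom_pos (μ : Measure Ω) [IsProbabilityMeasure μ] : 0 < minAtom μ ∧
    (∀ ω, μ.real {ω} ≠ 0 → minAtom μ ≤ μ.real {ω}) ∧ (minAtom μ = 1 ∨ minAtom μ ≤ 1 / 2) := by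
  have hp := sum_measureReal_singleton_eq_one μ
  have hne : ∀ ω, μ {ω} ≠ 0 ↔ μ.real {ω} ≠ 0 := fun ω => by
    rw [ne_eq, ne_eq, measureReal_eq_zero_iff]
  have : Nonempty {ω : Ω // μ {ω} ≠ 0} := by
    obtain ⟨ω, _, hω⟩ := Finset.exists_ne_zero_of_sum_ne_zero (hp.trans_ne one_ne_zero)
    exact ⟨ω, (hne ω).2 hω⟩
  obtain ⟨⟨ω₀, h₀⟩, hmin⟩ :=
    exists_eq_ciInf_of_finite (f := fun ω : {ω : Ω // μ {ω} ≠ 0} => μ.real {(ω : Ω)})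
  change μ.real {ω₀} = minAtom μ at hmin
  have hle : ∀ ω, μ.real {ω} ≠ 0 → minAtom μ ≤ μ.real {ω} := fun ω hω =>
    ciInf_le (f := fun ω : {ω : Ω // μ {ω} ≠ 0} => μ.real {(ω : Ω)})
      (Set.finite_range _).bddBelow ⟨ω, (hne ω).2 hω⟩
  refine ⟨hmin ▸ measureReal_nonneg.lt_of_ne' ((hne _).1 h₀), hle, ?_⟩
  classical
  rw [← Finset.add_sum_erase _ _ (Finset.mem_univ ω₀)] at hp
  -- Either `ω₀` carries all the mass, or there is a second atom at least as heavy.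
  by_cases h : ∑ ω ∈ Finset.univ.erase ω₀, μ.real {ω} = 0
  · left; linarith
  · right
    obtain ⟨ω₁, h₁, h₁'⟩ := Finset.exists_ne_zero_of_sum_ne_zero h
    have := Finset.single_le_sum (f := fun ω => μ.real {ω}) (fun ω _ => measureReal_nonneg) h₁
    have := hle ω₁ h₁'
    linarith

end FiniteMeasure

theorem exists_ofNat_eq {m : ℕ} (i : Fin (m + 1)) : ∃ j < m + 1, Fin.ofNat (m + 1) j = i :=
  ⟨i, i.2, by simp⟩

theorem sum_range_ofNat {m : ℕ} (h : Fin (m + 1) → ℝ) :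
    ∑ k ∈ Finset.range (m + 1), h (Fin.ofNat (m + 1) k) = ∑ i, h i := by
  rw [Finset.sum_range]; simp

/-! ### Inequalities for influences -/

section Influence

variable {Ω : Type*} [Finite Ω] [MeasurableSpace Ω] [MeasurableSingletonClass Ω]

theorem influence_nonneg (μ : Measure Ω) {n : ℕ} (f : (Fin n → Ω) → ℝ) (i : Fin n) :
    0 ≤ influence μ f i :=
  integral_nonneg fun _ => variance_nonneg _ _

/-- The Efron–Stein inequality. -/
theorem variance_le_sum_influence (μ : Measure Ω) [IsProbabilityMeasure μ] {n : ℕ}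
    (f : (Fin n → Ω) → ℝ) : variance f (powMeasure μ n) ≤ ∑ i, influence μ f i := by
  have := Fintype.ofFinite Ω
  have hp := sum_measureReal_singleton_eq_one μ
  rw [variance_powMeasure]
  simp only [influence_eq_coordEnergy]
  cases n with
  | zero =>
    have h : ∀ g : (Fin 0 → Ω) → ℝ, prodExp (fun ω => μ.real {ω}) g = g default := fun g => by
      simp [prodExp]
    simp [h]
  | succ m =>
    exact variance_le_sum_coordEnergy (fun _ => measureReal_nonneg) hp exists_ofNat_eq
      sum_range_ofNat f

theorem log_mul_variance_le_sum_influence (μ : Measure Ω) [IsProbabilityMeasure μ]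
    (hα : minAtom μ ≤ 1 / 2) {n : ℕ} {f : (Fin n → Ω) → ℝ} (hf : ∀ x, f x = 0 ∨ f x = 1)
    {δ : ℝ} (hδ : 0 < δ) (hI : ∀ i, influence μ f i ≤ δ) :
    Real.log (4 / δ) * variance f (powMeasure μ n) ≤
      38 * Real.log (1 / minAtom μ) * ∑ i, influence μ f i := by
  cases n with
  | zero =>
    have h := variance_le_sum_influence μ f
    rw [Fin.sum_univ_zero] at h ⊢
    rw [le_antisymm h (variance_nonneg _ _), mul_zero, mul_zero]
  | succ m =>
    have := Fintype.ofFinite Ω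
    obtain ⟨h1, h2, -⟩ := minAtom_pos μ
    rw [variance_powMeasure]
    simp only [influence_eq_coordEnergy] at hI ⊢
    exact log_mul_variance_le (fun _ => measureReal_nonneg) (sum_measureReal_singleton_eq_one μ)
      h1 hα h2 exists_ofNat_eq sum_range_ofNat hf hδ hI

theorem influence_eq_of_isSymmetricFun (μ : Measure Ω) [IsProbabilityMeasure μ] {n : ℕ}
    {f : (Fin n → Ω) → ℝ} (hf : IsSymmetricFun f) (i j : Fin n) :
    influence μ f i = influence μ f j := by
  have := Fintype.ofFinite Ω
  obtain ⟨G, hG, hinv⟩ := hf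
  obtain ⟨σ, hσ⟩ := hG.exists_smul_eq j i
  rw [influence_eq_coordEnergy, influence_eq_coordEnergy, ← hσ]
  exact coordEnergy_perm _ σ.1 (hinv σ.1 σ.2) j

theorem log_card_mul_variance_le_sum_influence (μ : Measure Ω) [IsProbabilityMeasure μ]
    (hα : minAtom μ ≤ 1 / 2) {n : ℕ} {f : (Fin n → Ω) → ℝ} (hf : ∀ x, f x = 0 ∨ f x = 1)
    (hsymm : IsSymmetricFun f) :
    Real.log n * variance f (powMeasure μ n) ≤
      76 * Real.log (1 / minAtom μ) * ∑ i, influence μ f i := by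
  have := Fintype.ofFinite Ω
  have hV0 := variance_nonneg f (powMeasure μ n)
  have hVI := variance_le_sum_influence μ f
  have hα0 := (minAtom_pos μ).1
  have hL : Real.log 2 ≤ Real.log (1 / minAtom μ) :=
    Real.log_le_log (by norm_num) (by rw [le_div_iff₀ hα0]; linarith)
  have hl2 := Real.log_two_gt_d9
  rcases Nat.eq_zero_or_pos n with rfl | hn
  · rw [Fin.sum_univ_zero] at hVI ⊢
    simp
  set u := influence μ f ⟨0, hn⟩ with hu
  have hsum : ∑ i, influence μ f i = n * u := by
    rw [Finset.sum_congr rfl fun i _ => influence_eq_of_isSymmetricFun μ hsymm i ⟨0, hn⟩]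
    simp [hu]
  have hu0 : 0 ≤ u := influence_nonneg μ f _
  have hn' : (0 : ℝ) < n := by exact_mod_cast hn
  have hlogn : Real.log n = 2 * Real.log (Real.sqrt n) := by
    rw [Real.log_sqrt hn'.le]; ring
  have hs := Real.sqrt_pos.2 hn'
  have hss := Real.mul_self_sqrt hn'.le
  -- The threshold `1/√n` costs a factor 2, since `log √n` is half of `log n`: hence 76. Above it,
  -- `n u ≥ √n ≥ log √n` suffices because the variance is at most 1.
  rcases le_total u (1 / Real.sqrt n) with h | h
  · have key := log_mul_variance_le_sum_influence μ hα hf (δ := 1 / Real.sqrt n)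
      (by positivity) fun i => (influence_eq_of_isSymmetricFun μ hsymm i ⟨0, hn⟩).trans_le h
    have h1 : Real.log (Real.sqrt n) ≤ Real.log (4 / (1 / Real.sqrt n)) :=
      Real.log_le_log hs (by rw [div_div_eq_mul_div, div_one]; linarith)
    have h2 := mul_le_mul_of_nonneg_right h1 hV0
    rw [hlogn]
    linarith
  · have hV1 : variance f (powMeasure μ n) ≤ 1 := by
      rw [variance_powMeasure]
      have hE : prodExp (fun ω => μ.real {ω}) (fun x => f x ^ 2) ≤
          prodExp (fun ω => μ.real {ω}) (fun _ : Fin n → Ω => 1) :=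
        prodExp_mono (fun _ => measureReal_nonneg) fun x => by
          rcases hf x with h | h <;> simp [h]
      rw [prodExp_const (sum_measureReal_singleton_eq_one μ)] at hE
      linarith [sq_nonneg (prodExp (fun ω => μ.real {ω}) f)]
    have h1 : Real.sqrt n ≤ n * u := by
      rw [div_le_iff₀ hs] at h
      nlinarith
    have h2 : Real.log (Real.sqrt n) ≤ Real.sqrt n :=
      (Real.log_le_sub_one_of_pos hs).trans (by linarith)
    have h3 : 2 * Real.sqrt n ≤ 76 * Real.log (1 / minAtom μ) * (n * u) := by nlinarith
    have h4 : 0 ≤ Real.log n := Real.log_natCast_nonneg n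
    rw [hsum]
    nlinarith

end Influence

theorem mainTheorem3 :
    ∃ C : ℝ, 0 < C ∧
      ∀ (Ω : Type*) [Finite Ω] [MeasurableSpace Ω] [MeasurableSingletonClass Ω]
        (μ : Measure Ω) [IsProbabilityMeasure μ] (n : ℕ) (f : (Fin n → Ω) → ℝ),
        (∀ x, f x = 0 ∨ f x = 1) →
        (IsSymmetricFun f →
          C / Real.log (1 / minAtom μ) * Real.log n * variance f (powMeasure μ n)
            ≤ ∑ i, influence μ f i) ∧
        (∀ δ : ℝ, 0 < δ → (∀ i, influence μ f i ≤ δ) →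
          C / Real.log (1 / minAtom μ) * (Real.log (1 / δ) - Real.log (1 / 4)) *
              variance f (powMeasure μ n)
            ≤ ∑ i, influence μ f i) := by
  refine ⟨1 / 76, by norm_num, ?_⟩
  intro Ω _ _ _ μ _ n f hf
  have := Fintype.ofFinite Ω
  have hI0 : 0 ≤ ∑ i, influence μ f i := Finset.sum_nonneg fun i _ => influence_nonneg μ f i
  obtain ⟨hα0, -, hα | hα⟩ := minAtom_pos μ
  -- Here `log (1/α) = 0`, and division by zero makes both left sides 0.
  · rw [hα]
    exact ⟨fun _ => by simpa using hI0, fun _ _ _ => by simpa using hI0⟩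
  have hL : 0 < Real.log (1 / minAtom μ) :=
    Real.log_pos (by rw [lt_div_iff₀ hα0]; linarith)
  have key : ∀ t, t ≤ 76 * Real.log (1 / minAtom μ) * ∑ i, influence μ f i →
      1 / 76 / Real.log (1 / minAtom μ) * t ≤ ∑ i, influence μ f i := by
    intro t ht
    rw [div_div, one_div_mul_eq_div, div_le_iff₀ (by positivity)]
    linarith
  refine ⟨fun hsymm => ?_, fun δ hδ hI => ?_⟩
  · rw [mul_assoc]
    exact key _ (log_card_mul_variance_le_sum_influence μ hα hf hsymm)
  · have e : Real.log (1 / δ) - Real.log (1 / 4) = Real.log (4 / δ) := by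
      rw [← Real.log_div (by positivity) (by norm_num)]
      congr 1
      field_simp
    rw [mul_assoc, e]
    refine key _ ((log_mul_variance_le_sum_influence μ hα hf hδ hI).trans ?_)
    exact mul_le_mul_of_nonneg_right (by linarith) hI0
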